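/- Let $\Gamma$ be a word hyperbolic group (with a fixed finite generating set), $G\subset GL_n(\mathbb C)$ a complex semisimple linear algebraic group, $P\subset G$ a self-opposite parabolic subgroup, $H\subset G$ a closed subgroup such that $P\backslash G/H$ is finite, $\mathcal X=G/H$, and $I\subset P\backslash G/H$ an ideal for the order $p\le q\iff p\subset\overline q$. For $g_1,g_2\in G$ put $\mathrm{pos}(g_1P,g_2H)=Pg_1^{-1}g_2H$. For a $P$-Anosov representation $\rho:\Gamma\to G$ with limit map $\xi_\rho:\partial_\infty\Gamma\to G/P$ put $$\Omega^I_\rho=\mathcal X\smallsetminus\bigcup_{z\in\partial_\infty\Gamma}\{x\in\mathcal X:\ \mathrm{pos}(\xi_\rho(z),x)\in I\}.$$ When $M=\Omega^I_\rho$ carries the structure of a complex manifold of dimension $1$ on which $\rho(\Gamma)$ acts holomorphically, let $\mathcal E_\rho^h=h^*T^{1,0}M=\{(m,x)\in M\times T^{1,0}M:\ x \text{ lies over } hm\}$ for $h\in\rho(\Gamma)$ (so $\mathcal E_\rho^h=\mathcal E_\rho^{h'}$ if and only if $h$ and $h'$ agree on $M$), and let $F_\rho$ be the free group on the set $\{\mathcal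 E_\rho^h: h\in\rho(\Gamma)\}$, with formal tensor product as multiplication, formal duals as inverses and the trivial bundle as identity ($F_\rho$ is trivial if $M=\emptyset$). Let $\mathrm{Hom}_P^{zd}(\Gamma,G)$ be the set of Zariski dense $P$-Anosov representations $\Gamma\to G$. **Theorem.** Let $\rho\in \mathrm{Hom}_P^{zd}(\Gamma,G)$ and $g\in G$. 1. $g\rho g^{-1}\in \mathrm{Hom}_P^{zd}(\Gamma,G)$, and if $\xi$ is the limit map of $\rho$, then $g\xi$ is the limit map of $g\rho g^{-1}$. 2. $\Omega^I_{g\rho g^{-1}}=g\,\Omega^I_\rho$. 3. If $\Omega^I_\rho$ has a complex structure as above, then $\Omega^I_{g\rho g^{-1}}$ has one for which $m\mapsto gm$ is biholomorphic. For any complex structures as above on $\Omega^I_\rho$ and on $\Omega^I_{g\rho g^{-1}}$ there is a group isomorphism $\psi:F_\rho\to F_{g\rho g^{-1}}$ with $\psi(\mathcal E_\rho^h)=\mathcal E_{g\rho g^{-1}}^{ghg^{-1}}$ for all $h\in\rho(\Gamma)$. Consequently $F_\rho$ is well defined up to isomorphism on the character variety: there is an assignment $\Phi$ of a group to each point of $\mathrm{Hom}_P^{zd}(\Gamma,G)/G$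 such that $F_\rho\cong\Phi([\rho])$ for every $\rho\in \mathrm{Hom}_P^{zd}(\Gamma,G)$ and every complex structure as above on $\Omega^I_\rho$. -/

import Mathlib

open Filter Topology
open scoped Manifold ContDiff TensorProduct Pointwise

noncomputable section

namespace AnosovFree

/-! ### Gromov hyperbolicity and the Gromov boundary -/

section Hyperbolic

/-- The Gromov product `(x | y)_o` for a distance function `d`. -/
def gromovProduct {X : Type*} (d : X → X → ℝ) (o x y : X) : ℝ :=
  (d o x + d o y - d x y) / 2

/-- Gromov's four-point definition of a hyperbolic space. -/
def IsGromovHyperbolic {X : Type*} (d : X → X → ℝ) : Prop :=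
  ∃ δ : ℝ, ∀ o x y z : X,
    min (gromovProduct d o x y) (gromovProduct d o y z) - δ ≤ gromovProduct d o x z

/-- Quasi-isometric embeddings. -/
def IsQIEmbedding {X Y : Type*} (d : X → X → ℝ) (d' : Y → Y → ℝ) (f : X → Y) : Prop :=
  ∃ L C : ℝ, 1 ≤ L ∧ 0 ≤ C ∧ ∀ x y : X,
    d x y / L - C ≤ d' (f x) (f y) ∧ d' (f x) (f y) ≤ L * d x y + C

/-- Quasi-isometries: coarsely surjective quasi-isometric embeddings. -/
def IsQuasiIsometry {X Y : Type*} (d : X → X → ℝ) (d' : Y → Y → ℝ) (f : X → Y) : Prop :=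
  IsQIEmbedding d d' f ∧ ∃ R : ℝ, ∀ y : Y, ∃ x : X, d' (f x) y ≤ R

/-- Two sequences are asymptotic if `(x_i | y_j)_o → ∞` as `i, j → ∞`. -/
def Asymptotic {X : Type*} (d : X → X → ℝ) (x y : ℕ → X) : Prop :=
  ∀ o : X, Tendsto (fun p : ℕ × ℕ => gromovProduct d o (x p.1) (y p.2)) atTop atTop

/-- Sequences converging to infinity: `(x_i | x_j)_o → ∞` as `i, j → ∞`. -/
def GromovSeq {X : Type*} (d : X → X → ℝ) : Type _ :=
  {x : ℕ → X // Asymptotic d x x}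

/-- The Gromov boundary: sequences converging to infinity, up to being asymptotic
(which is an equivalence relation on them when `d` is a hyperbolic metric). -/
def GromovBoundary {X : Type*} (d : X → X → ℝ) : Type _ :=
  Quot (fun x y : GromovSeq d => Asymptotic d x.1 y.1)

/-- The boundary point represented by a sequence converging to infinity. -/
def GromovBoundary.mk {X : Type*} {d : X → X → ℝ} (x : GromovSeq d) : GromovBoundary d :=
  Quot.mk _ x

/-- The basic neighbourhood of `z`: all `w` such that some sequences `x` representing `z` and `y`
representing `w` satisfy `(x_i | y_j)_o ≥ r` for all large `i, j`. -/
def boundaryNhd {X : Type*} (d : X → X → ℝ) (o : X) (z : GromovBoundary d) (r : ℝ) :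
    Set (GromovBoundary d) :=
  {w | ∃ x y : GromovSeq d, GromovBoundary.mk x = z ∧ GromovBoundary.mk y = w ∧
    ∀ᶠ p : ℕ × ℕ in atTop, r ≤ gromovProduct d o (x.1 p.1) (y.1 p.2)}

/-- The usual topology of the Gromov boundary. -/
instance {X : Type*} (d : X → X → ℝ) : TopologicalSpace (GromovBoundary d) where
  IsOpen U := ∀ z ∈ U, ∀ o : X, ∃ r : ℝ, boundaryNhd d o z r ⊆ U
  isOpen_univ := fun _ _ _ => ⟨0, Set.subset_univ _⟩
  isOpen_inter := by
    intro U V hU hV z hz o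
    obtain ⟨r, hr⟩ := hU z hz.1 o
    obtain ⟨s, hs⟩ := hV z hz.2 o
    refine ⟨max r s, ?_⟩
    rintro w ⟨x, y, hx, hy, h⟩
    exact ⟨hr ⟨x, y, hx, hy, h.mono fun p hp => (le_max_left r s).trans hp⟩,
      hs ⟨x, y, hx, hy, h.mono fun p hp => (le_max_right r s).trans hp⟩⟩
  isOpen_sUnion := by
    intro 𝒰 h𝒰 z hz o
    obtain ⟨U, hU, hzU⟩ := hz
    obtain ⟨r, hr⟩ := h𝒰 U hU z hzU o
    exact ⟨r, hr.trans (Set.subset_sUnion_of_mem hU)⟩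

end Hyperbolic

/-! ### Word hyperbolic groups -/

section WordMetric

variable {Γ : Type*} [Group Γ]

/-- Word length with respect to a set `S`. -/
def wordLength (S : Set Γ) (γ : Γ) : ℕ :=
  sInf {k : ℕ | ∃ l : List Γ, l.length = k ∧ (∀ s ∈ l, s ∈ S ∨ s⁻¹ ∈ S) ∧ l.prod = γ}

/-- The (left-invariant) word metric. -/
def wordDist (S : Set Γ) (x y : Γ) : ℝ := wordLength S (x⁻¹ * y)

/-- `Γ` is a word hyperbolic group with finite generating set `S`. -/
def IsWordHyperbolic (S : Set Γ) : Prop :=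
  S.Finite ∧ Subgroup.closure S = ⊤ ∧ IsGromovHyperbolic (wordDist S)

theorem gromovProduct_mul_left (S : Set Γ) (γ o x y : Γ) :
    gromovProduct (wordDist S) o (γ * x) (γ * y) =
      gromovProduct (wordDist S) (γ⁻¹ * o) x y := by
  simp [gromovProduct, wordDist, mul_assoc]

theorem asymptotic_mul_left {S : Set Γ} (γ : Γ) {x y : ℕ → Γ}
    (h : Asymptotic (wordDist S) x y) :
    Asymptotic (wordDist S) (fun n => γ * x n) (fun n => γ * y n) := by
  intro o
  simpa only [gromovProduct_mul_left] using h (γ⁻¹ * o)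

/-- The boundary at infinity `∂_∞ Γ`. -/
abbrev Bdry (S : Set Γ) : Type _ := GromovBoundary (wordDist S)

/-- The action of `Γ` on its boundary by left translation. -/
def bdryAct {S : Set Γ} (γ : Γ) : Bdry S → Bdry S :=
  Quot.map (fun x => ⟨fun n => γ * x.1 n, asymptotic_mul_left γ x.2⟩)
    (fun _ _ h => asymptotic_mul_left γ h)

/-- Ordered pairs of distinct boundary points. -/
abbrev BdryPairs (S : Set Γ) : Type _ := {p : Bdry S × Bdry S // p.1 ≠ p.2}

/-- A Gromov geodesic flow space `Γ̂` of a word hyperbolic group `Γ`: a proper hyperbolic metric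
space with commuting actions of `Γ` and `ℝ ⋊ ℤ/2` such that `Γ × ℤ/2` acts by isometries, the
`Γ`-orbit maps are quasi-isometries (so that `∂Γ ≅ ∂Γ̂`), the `ℝ`-action is free with
quasi-isometrically embedded orbits, and the endpoint map induces a homeomorphism from `Γ̂/ℝ` onto
the space of ordered pairs of distinct boundary points. -/
structure FlowSpace (S : Set Γ) where
  /-- the underlying space `Γ̂` -/
  carrier : Type
  [metric : MetricSpace carrier]
  [proper : ProperSpace carrier]
  [action : MulAction Γ carrier]
  hyperbolic : IsGromovHyperbolic (fun x y : carrier => dist x y)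
  isometry_smul : ∀ γ : Γ, Isometry (fun m : carrier => γ • m)
  /-- the action of `ℝ` -/
  flow : Flow ℝ carrier
  /-- the generator of `ℤ/2` -/
  flip : carrier → carrier
  isometry_flip : Isometry flip
  flip_flip : ∀ m, flip (flip m) = m
  flip_smul : ∀ (γ : Γ) m, flip (γ • m) = γ • flip m
  flip_flow : ∀ t m, flip (flow t m) = flow (-t) (flip m)
  flow_smul : ∀ (γ : Γ) t m, flow t (γ • m) = γ • flow t m
  orbit_quasiIsometry : ∀ m : carrier,
    IsQuasiIsometry (wordDist S) (fun x y : carrier => dist x y) (fun γ : Γ => γ • m)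
  /-- the identification of boundaries induced by the orbit maps -/
  bdry : Bdry S ≃ₜ GromovBoundary (fun x y : carrier => dist x y)
  bdry_spec : ∀ (m : carrier) (x : GromovSeq (wordDist S)),
    ∃ y : GromovSeq (fun x y : carrier => dist x y),
      (∀ n, y.1 n = x.1 n • m) ∧ bdry (GromovBoundary.mk x) = GromovBoundary.mk y
  flow_free : ∀ t m, flow t m = m → t = 0
  flow_qiEmbedding : ∀ m : carrier,
    IsQIEmbedding (fun s t : ℝ => dist s t) (fun x y : carrier => dist x y) (fun t => flow t m)
  /-- the endpoints `(τ⁺ m, τ⁻ m)` of the flow line through `m` -/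
  endpoints : carrier → BdryPairs S
  endpoint_plus : ∀ m : carrier, ∃ x : GromovSeq (fun x y : carrier => dist x y),
    (∀ n : ℕ, x.1 n = flow (n : ℝ) m) ∧ bdry (endpoints m).1.1 = GromovBoundary.mk x
  endpoint_minus : ∀ m : carrier, ∃ x : GromovSeq (fun x y : carrier => dist x y),
    (∀ n : ℕ, x.1 n = flow (-(n : ℝ)) m) ∧ bdry (endpoints m).1.2 = GromovBoundary.mk x
  endpoints_eq_iff : ∀ m m' : carrier, endpoints m = endpoints m' ↔ ∃ t : ℝ, flow t m = m'
  endpoints_quotient : IsQuotientMap endpoints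

attribute [instance] FlowSpace.metric FlowSpace.proper FlowSpace.action

end WordMetric

/-! ### Complex semisimple algebraic groups and parabolic subgroups -/

section LieGroups

variable {n : ℕ}

/-- A set of invertible matrices cut out by polynomials in the entries. -/
def IsZariskiClosed (A : Set (GL (Fin n) ℂ)) : Prop :=
  ∃ F : Set (MvPolynomial (Fin n × Fin n) ℂ), ∀ g : GL (Fin n) ℂ,
    g ∈ A ↔ ∀ f ∈ F, MvPolynomial.eval (fun p => (g : Matrix (Fin n) (Fin n) ℂ) p.1 p.2) f = 0

/-- A complex semisimple linear algebraic group: a Zariski closed subgroup of `GL_n(ℂ)` whose only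
closed connected solvable normal subgroup is trivial. -/
def IsSemisimpleAlgebraic (G : Subgroup (GL (Fin n) ℂ)) : Prop :=
  IsZariskiClosed (G : Set (GL (Fin n) ℂ)) ∧
    ∀ N : Subgroup G, N.Normal → IsClosed (N : Set G) → IsConnected (N : Set G) →
      Group.IsSolvable N → N = ⊥

/-- The real Lie algebra of a closed subgroup `K` of `GL_n(ℂ)`: all `Y` with `exp(tY) ∈ K` for
all real `t`. (For closed `K` these `Y` already form a real subspace.) -/
def lieAlg (K : Subgroup (GL (Fin n) ℂ)) : Submodule ℝ (Matrix (Fin n) (Fin n) ℂ) :=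
  Submodule.span ℝ {Y | ∀ t : ℝ, ∃ u ∈ K,
    (u : Matrix (Fin n) (Fin n) ℂ) = NormedSpace.exp (t • Y)}

/-- The adjoint action `Ad(g) Y = g Y g⁻¹`. -/
def Ad (g : GL (Fin n) ℂ) (Y : Matrix (Fin n) (Fin n) ℂ) : Matrix (Fin n) (Fin n) ℂ :=
  (g : Matrix (Fin n) (Fin n) ℂ) * Y * ((g⁻¹ : GL (Fin n) ℂ) : Matrix (Fin n) (Fin n) ℂ)

/-- The eigenspace of `ad X` on the Lie algebra of `G` for the real eigenvalue `c`. -/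
def adEigenspace (G : Subgroup (GL (Fin n) ℂ)) (X : Matrix (Fin n) (Fin n) ℂ) (c : ℝ) :
    Submodule ℝ (Matrix (Fin n) (Fin n) ℂ) :=
  lieAlg G ⊓ Module.End.eigenspace
    (LinearMap.mulLeft ℝ X - LinearMap.mulRight ℝ X : Module.End ℝ (Matrix (Fin n) (Fin n) ℂ)) c

/-- `X` lies in the Lie algebra of `G` and `ad X` is diagonalizable with real eigenvalues. -/
def IsHyperbolicElement (G : Subgroup (GL (Fin n) ℂ)) (X : Matrix (Fin n) (Fin n) ℂ) : Prop :=
  X ∈ lieAlg G ∧ (⨆ c : ℝ, adEigenspace G X c) = lieAlg G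

/-- The parabolic subalgebra of `X`: the sum of the eigenspaces of `ad X` with eigenvalue `≥ 0`. -/
def parabolicAlg (G : Subgroup (GL (Fin n) ℂ)) (X : Matrix (Fin n) (Fin n) ℂ) :
    Submodule ℝ (Matrix (Fin n) (Fin n) ℂ) :=
  ⨆ c : {c : ℝ // 0 ≤ c}, adEigenspace G X c.1

/-- `P` is the normalizer in `G` of the subspace `V`. -/
def IsNormalizerOf (G : Subgroup (GL (Fin n) ℂ)) (P : Subgroup G)
    (V : Submodule ℝ (Matrix (Fin n) (Fin n) ℂ)) : Prop :=
  ∀ g : G, g ∈ P ↔ ∀ Y, Y ∈ V ↔ Ad (g : GL (Fin n) ℂ) Y ∈ V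

/-- `(P, Q)` is a pair of opposite parabolic subgroups of `G`. -/
def IsOppositeParabolicPair (G : Subgroup (GL (Fin n) ℂ)) (P Q : Subgroup G) : Prop :=
  ∃ X, IsHyperbolicElement G X ∧
    IsNormalizerOf G P (parabolicAlg G X) ∧ IsNormalizerOf G Q (parabolicAlg G (-X))

/-- `P` is a parabolic subgroup of `G` that is conjugate to an opposite parabolic subgroup. -/
def IsSelfOppositeParabolic (G : Subgroup (GL (Fin n) ℂ)) (P : Subgroup G) : Prop :=
  ∃ Q : Subgroup G, IsOppositeParabolicPair G P Q ∧ ∃ w : G, Q = P.map (MulAut.conj w).toMonoidHom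

/-- The Lie algebra of the stabilizer of a point `x` of `G/P`; the tangent space of `G/P` at `x` is
the quotient of the Lie algebra of `G` by it. -/
def stabAlg {G : Subgroup (GL (Fin n) ℂ)} {P : Subgroup G} (x : G ⧸ P) :
    Submodule ℝ (Matrix (Fin n) (Fin n) ℂ) :=
  lieAlg ((MulAction.stabilizer G x).map G.subtype)

end LieGroups

/-! ### Anosov representations -/

section Anosov

variable {Γ : Type*} [Group Γ] {n : ℕ} {G : Subgroup (GL (Fin n) ℂ)}

/-- A continuous `ρ`-equivariant family of norms on the tangent spaces `T_{ξ(τ(m))}(G/P)`,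
`m ∈ Γ̂`. A norm on the tangent space `Lie(G) / stabAlg x` is written as a seminorm on `Lie(G)` with
kernel `stabAlg x`, and `g` maps the class of `Y` at `x` to the class of `Ad(g) Y` at `g x`. -/
structure IsNormFamily {S : Set Γ} (𝓕 : FlowSpace S) (ρ : Γ →* G) {P : Subgroup G}
    (ξ : Bdry S → G ⧸ P) (τ : 𝓕.carrier → Bdry S)
    (N : 𝓕.carrier → Seminorm ℝ (lieAlg G)) : Prop where
  norm_eq_zero_iff : ∀ m (Y : lieAlg G),
    N m Y = 0 ↔ (Y : Matrix (Fin n) (Fin n) ℂ) ∈ stabAlg (ξ (τ m))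
  continuous : Continuous (fun p : 𝓕.carrier × lieAlg G => N p.1 p.2)
  equivariant : ∀ (γ : Γ) m (Y Y' : lieAlg G),
    (Y' : Matrix (Fin n) (Fin n) ℂ) = Ad (ρ γ : GL (Fin n) ℂ) Y → N (γ • m) Y' = N m Y

/-- `ρ` is `(P, Q)`-Anosov with limit maps `ξp` and `ξm`. -/
structure IsAnosovWith (S : Set Γ) {P Q : Subgroup G} (ρ : Γ →* G)
    (ξp : Bdry S → G ⧸ P) (ξm : Bdry S → G ⧸ Q) : Prop where
  continuous_plus : Continuous ξp
  continuous_minus : Continuous ξm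
  equivariant_plus : ∀ (γ : Γ) z, ξp (bdryAct γ z) = ρ γ • ξp z
  equivariant_minus : ∀ (γ : Γ) z, ξm (bdryAct γ z) = ρ γ • ξm z
  transverse : ∀ z w, z ≠ w → ∃ g : G, ξp z = (g : G ⧸ P) ∧ ξm w = (g : G ⧸ Q)
  contraction : ∃ (𝓕 : FlowSpace S) (Np Nm : 𝓕.carrier → Seminorm ℝ (lieAlg G)),
    IsNormFamily 𝓕 ρ ξp (fun m => (𝓕.endpoints m).1.1) Np ∧
    IsNormFamily 𝓕 ρ ξm (fun m => (𝓕.endpoints m).1.2) Nm ∧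
    ∃ A a : ℝ, 0 < A ∧ 0 < a ∧ ∀ t : ℝ, 0 ≤ t → ∀ m (Y : lieAlg G),
      Np (𝓕.flow (-t) m) Y ≤ A * Real.exp (-a * t) * Np m Y ∧
      Nm (𝓕.flow t m) Y ≤ A * Real.exp (-a * t) * Nm m Y

/-- `ξ` is the limit map (into `G/P`) of the `P`-Anosov representation `ρ`. -/
def IsLimitMap (S : Set Γ) (P : Subgroup G) (ρ : Γ →* G) (ξ : Bdry S → G ⧸ P) : Prop :=
  ∃ (Q : Subgroup G) (ξm : Bdry S → G ⧸ Q),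
    IsOppositeParabolicPair G P Q ∧ IsAnosovWith S ρ ξ ξm

/-- The image of `ρ` is Zariski dense in `G`. -/
def IsZariskiDense (ρ : Γ →* G) : Prop :=
  ∀ f : MvPolynomial (Fin n × Fin n) ℂ,
    (∀ γ : Γ, MvPolynomial.eval
      (fun p => ((ρ γ : GL (Fin n) ℂ) : Matrix (Fin n) (Fin n) ℂ) p.1 p.2) f = 0) →
    ∀ g : G, MvPolynomial.eval
      (fun p => ((g : GL (Fin n) ℂ) : Matrix (Fin n) (Fin n) ℂ) p.1 p.2) f = 0

/-- The set `Hom_P^zd(Γ, G)` of Zariski dense `P`-Anosov representations. -/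
def homZD (S : Set Γ) (P : Subgroup G) : Set (Γ →* G) :=
  {ρ | IsZariskiDense ρ ∧ ∃ ξ : Bdry S → G ⧸ P, IsLimitMap S P ρ ξ}

/-- The conjugate representation `g ρ g⁻¹`. -/
def conjRep (g : G) (ρ : Γ →* G) : Γ →* G := (MulAut.conj g).toMonoidHom.comp ρ

/-- Conjugacy of Zariski dense `P`-Anosov representations. -/
def conjSetoid (S : Set Γ) (P : Subgroup G) : Setoid (homZD S P) where
  r ρ ρ' := ∃ g : G, ρ'.1 = conjRep g ρ.1
  iseqv := by
    refine ⟨fun ρ => ⟨1, ?_⟩, ?_, ?_⟩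
    · ext γ : 1
      simp [conjRep]
    · rintro ρ ρ' ⟨g, hg⟩
      refine ⟨g⁻¹, ?_⟩
      ext γ : 1
      simp [conjRep, hg, mul_assoc]
    · rintro ρ ρ' ρ'' ⟨g, hg⟩ ⟨k, hk⟩
      refine ⟨k * g, ?_⟩
      ext γ : 1
      simp [conjRep, hg, hk, mul_assoc]

/-- The character variety `Hom_P^zd(Γ, G) / G`. -/
def CharacterVariety (S : Set Γ) (P : Subgroup G) : Type _ := Quotient (conjSetoid S P)

/-- The conjugacy class of a representation. -/
def CharacterVariety.mk {S : Set Γ} {P : Subgroup G} (ρ : homZD S P) : CharacterVariety S P :=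
  Quotient.mk (conjSetoid S P) ρ

end Anosov

/-! ### Relative positions and the domain `Ω_ρ^I` -/

section Domain

variable {n : ℕ} {G : Subgroup (GL (Fin n) ℂ)}

/-- The double coset space `P \ G / H`, i.e. the set of `G`-orbits in `G/P × G/H`. -/
abbrev DCoset (P H : Subgroup G) : Type := DoubleCoset.Quotient (P : Set G) (H : Set G)

/-- The relative position `pos(g₁P, g₂H) = P g₁⁻¹ g₂ H`. -/
def pos {P H : Subgroup G} : G ⧸ P → G ⧸ H → DCoset P H :=
  Quotient.map₂ (fun g₁ g₂ => g₁⁻¹ * g₂) (by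
    intro a a' ha b b' hb
    have ha' : a⁻¹ * a' ∈ P := QuotientGroup.leftRel_apply.mp ha
    have hb' : b⁻¹ * b' ∈ H := QuotientGroup.leftRel_apply.mp hb
    refine DoubleCoset.rel_iff.mpr ⟨(a⁻¹ * a')⁻¹, P.inv_mem ha', b⁻¹ * b', hb', ?_⟩
    group)

/-- The double coset as a subset of `G`. -/
def DCoset.toSet {P H : Subgroup G} (p : DCoset P H) : Set G := {g | DoubleCoset.mk P H g = p}

/-- `I ⊆ P \ G / H` is an ideal for the closure order (`p ≤ q` iff `p ⊆ closure q`). -/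
def IsPosIdeal {P H : Subgroup G} (I : Set (DCoset P H)) : Prop :=
  ∀ p ∈ I, ∀ p' : DCoset P H, p'.toSet ⊆ closure p.toSet → p' ∈ I

variable {Γ : Type*} [Group Γ]

/-- `Ω_ρ^I = G/H ∖ ⋃_z {x | pos(ξ_ρ(z), x) ∈ I}`. The limit map `ξ_ρ` of an Anosov representation
is unique, so the quantifier over `ξ` ranges over one map. -/
def domain (S : Set Γ) (P H : Subgroup G) (I : Set (DCoset P H)) (ρ : Γ →* G) : Set (G ⧸ H) :=
  {x | ∀ ξ : Bdry S → G ⧸ P, IsLimitMap S P ρ ξ → ∀ z, pos (ξ z) x ∉ I}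

end Domain

/-! ### Complex curves, the pullback bundles and the free group -/

section Bundles

/-- The fibre at `m` of `T^{1,0}M`: the `i`-eigenspace of the complex-linear extension of the
complex structure `J = (v ↦ i v)` to the complexification `ℂ ⊗ T_m M`. -/
def T10 {M : Type*} [TopologicalSpace M] [ChartedSpace ℂ M] (m : M) :
    Submodule ℂ (ℂ ⊗[ℝ] TangentSpace 𝓘(ℂ, ℂ) m) :=
  Module.End.eigenspace
    (LinearMap.baseChange ℂ
      (LinearMap.restrictScalars ℝ (LinearMap.lsmul ℂ (TangentSpace 𝓘(ℂ, ℂ) m) Complex.I)))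
    Complex.I

variable {n : ℕ} {G : Subgroup (GL (Fin n) ℂ)} {H : Subgroup G} {Γ : Type*} [Group Γ]

/-- A structure of complex curve (complex manifold of dimension one) on the subset `M` of `G/H` for
which `ρ(Γ)` acts on `M` by holomorphic maps. -/
structure CurveStructure (ρ : Γ →* G) (M : Set (G ⧸ H)) where
  charted : ChartedSpace ℂ M
  isManifold : IsManifold 𝓘(ℂ, ℂ) ω M
  holomorphic : ∀ γ : Γ, ∃ f : M → M, (∀ m, (f m : G ⧸ H) = ρ γ • (m : G ⧸ H)) ∧
    MDifferentiable 𝓘(ℂ, ℂ) 𝓘(ℂ, ℂ) f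

/-- The bijection `f` is biholomorphic for the given complex structures. -/
def CurveStructure.IsBiholomorphic {ρ ρ' : Γ →* G} {M M' : Set (G ⧸ H)}
    (C : CurveStructure ρ M) (C' : CurveStructure ρ' M') (f : M ≃ M') : Prop :=
  letI := C.charted
  letI := C'.charted
  MDifferentiable 𝓘(ℂ, ℂ) 𝓘(ℂ, ℂ) f ∧ MDifferentiable 𝓘(ℂ, ℂ) 𝓘(ℂ, ℂ) f.symm

/-- The total space of the bundle `T^{1,0}M`. -/
def CurveStructure.TotalT10 {ρ : Γ →* G} {M : Set (G ⧸ H)} (C : CurveStructure ρ M) : Type :=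
  letI := C.charted
  Σ m : M, T10 m

/-- The pullback bundle `𝓔^h = h^* T^{1,0}M = {(m, x) ∈ M × T^{1,0}M | x lies over h m}`. -/
def CurveStructure.pullbackBundle {ρ : Γ →* G} {M : Set (G ⧸ H)} (C : CurveStructure ρ M) (h : G) :
    Set (M × C.TotalT10) :=
  {p | (p.2.1 : G ⧸ H) = h • (p.1 : G ⧸ H)}

/-- The set of line bundles `{𝓔^h | h ∈ ρ(Γ)}`; it is taken to be empty if `M = ∅`. -/
def CurveStructure.lineBundles {ρ : Γ →* G} {M : Set (G ⧸ H)} (C : CurveStructure ρ M) :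
    Set (Set (M × C.TotalT10)) :=
  {E | M.Nonempty ∧ ∃ h ∈ ρ.range, E = C.pullbackBundle h}

/-- The free group `F_ρ`: words in the symbols `𝓔^h` and their duals `(𝓔^h)^*` (the formal
inverses), modulo cancellation of adjacent dual pairs; the product is the formal tensor product
and the trivial bundle `𝓞` is the empty word. -/
abbrev CurveStructure.freeGroup {ρ : Γ →* G} {M : Set (G ⧸ H)} (C : CurveStructure ρ M) : Type :=
  FreeGroup C.lineBundles

end Bundles

end AnosovFree

end

/-!
Everything attached to a representation `ρ` is built from data on which `G` acts, and conjugating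
`ρ` by `g` moves these data by `g`.

* The limit maps `(ξ⁺, ξ⁻)` of `ρ` are replaced by `(g ξ⁺, g ξ⁻)`. Since the stabilizer of `g x` is
  the `g`-conjugate of the stabilizer of `x`, `Ad(g)` carries the tangent space of `G/P` at `x` to
  the one at `g x`; the norms `N m ∘ Ad(g⁻¹)` then form an equivariant family for `g ρ g⁻¹` on the
  same flow space, with the same contraction constants (`IsLimitMap.conj`). Zariski density is kept
  because `u ↦ g u g⁻¹` is polynomial in the entries of `u` (`IsZariskiDense.conj`).
* The relative position is `G`-invariant, so `Ω` is equivariant (`domain_conjRep`).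
* A complex structure on `Ω_ρ` is pushed forward along the homeomorphism `m ↦ g m`
  (`CurveStructure.transport`).
* For nonempty `M`, the bundle `𝓔^h` determines and is determined by the map `m ↦ h m` on `M`,
  because no fibre of `T^{1,0}M` is empty. This map does not involve the complex structure, so
  `𝓔^h ↦ 𝓔^{g h g⁻¹}` is a bijection between the sets of bundles, and it extends to the free groups
  (`CurveStructure.exists_freeGroup_mulEquiv`).

The assignment on the character variety picks a representation and a complex structure in each
class that has them; by the last point another choice gives an isomorphic free group.
-/

noncomputable section

namespace AnosovFree

/-! ### The adjoint action and Lie algebras of conjugate subgroups -/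

section Adjoint

variable {n : ℕ}

theorem Ad_mul (g k : GL (Fin n) ℂ) (Y : Matrix (Fin n) (Fin n) ℂ) :
    Ad (g * k) Y = Ad g (Ad k Y) := by
  simp only [Ad, mul_inv_rev, Units.val_mul, mul_assoc]

theorem Ad_one (Y : Matrix (Fin n) (Fin n) ℂ) : Ad 1 Y = Y := by
  simp [Ad]

theorem Ad_inv_Ad (g : GL (Fin n) ℂ) (Y : Matrix (Fin n) (Fin n) ℂ) : Ad g⁻¹ (Ad g Y) = Y := by
  rw [← Ad_mul, inv_mul_cancel, Ad_one]

theorem Ad_Ad_inv (g : GL (Fin n) ℂ) (Y : Matrix (Fin n) (Fin n) ℂ) : Ad g (Ad g⁻¹ Y) = Y := by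
  rw [← Ad_mul, mul_inv_cancel, Ad_one]

theorem continuous_Ad (g : GL (Fin n) ℂ) : Continuous (Ad g) := by
  unfold Ad
  fun_prop

/-- `Ad(g)` as a real linear map. -/
def adLinear (g : GL (Fin n) ℂ) :
    Matrix (Fin n) (Fin n) ℂ →ₗ[ℝ] Matrix (Fin n) (Fin n) ℂ where
  toFun := Ad g
  map_add' Y Z := by simp [Ad, mul_add, add_mul]
  map_smul' c Y := by simp [Ad]

theorem adLinear_apply (g : GL (Fin n) ℂ) (Y : Matrix (Fin n) (Fin n) ℂ) :
    adLinear g Y = Ad g Y := rfl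

theorem Ad_mem_lieAlg {K K' : Subgroup (GL (Fin n) ℂ)} (g : GL (Fin n) ℂ)
    (hK : ∀ u ∈ K, g * u * g⁻¹ ∈ K') {Y : Matrix (Fin n) (Fin n) ℂ} (hY : Y ∈ lieAlg K) :
    Ad g Y ∈ lieAlg K' := by
  have hle : lieAlg K ≤ (lieAlg K').comap (adLinear g) := by
    refine Submodule.span_le.mpr fun Z hZ => Submodule.subset_span fun t => ?_
    obtain ⟨u, hu, huZ⟩ := hZ t
    refine ⟨g * u * g⁻¹, hK u hu, ?_⟩
    rw [← map_smul, adLinear_apply, Ad, Matrix.exp_units_conj, ← huZ]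
    simp only [Units.val_mul]
  exact hle hY

variable {G : Subgroup (GL (Fin n) ℂ)}

theorem Ad_mem_lieAlg_self (g : G) {Y : Matrix (Fin n) (Fin n) ℂ} (hY : Y ∈ lieAlg G) :
    Ad (g : GL (Fin n) ℂ) Y ∈ lieAlg G :=
  Ad_mem_lieAlg _ (fun _ hu => G.mul_mem (G.mul_mem g.2 hu) (G.inv_mem g.2)) hY

theorem Ad_mem_stabAlg {P : Subgroup G} (g : G) (x : G ⧸ P) {Y : Matrix (Fin n) (Fin n) ℂ}
    (hY : Y ∈ stabAlg x) : Ad (g : GL (Fin n) ℂ) Y ∈ stabAlg (g • x) := by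
  refine Ad_mem_lieAlg _ ?_ hY
  rintro _ ⟨u, hu, rfl⟩
  have hu' : u • x = x := hu
  refine ⟨g * u * g⁻¹, ?_, by simp⟩
  change (g * u * g⁻¹) • g • x = g • x
  rw [smul_smul, inv_mul_cancel_right, mul_smul, hu']

theorem Ad_inv_mem_stabAlg_iff {P : Subgroup G} (g : G) (x : G ⧸ P)
    (Y : Matrix (Fin n) (Fin n) ℂ) :
    Ad (g : GL (Fin n) ℂ)⁻¹ Y ∈ stabAlg x ↔ Y ∈ stabAlg (g • x) := by
  constructor <;> intro h
  · simpa only [Ad_Ad_inv] using Ad_mem_stabAlg g x h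
  · simpa only [inv_smul_smul, Subgroup.coe_inv] using Ad_mem_stabAlg g⁻¹ (g • x) h

/-- `Ad(g⁻¹)` as a linear endomorphism of the Lie algebra of `G`. -/
def adInvLie (g : G) : lieAlg G →ₗ[ℝ] lieAlg G :=
  (adLinear (g : GL (Fin n) ℂ)⁻¹).restrict fun _ hY => by
    simpa only [Subgroup.coe_inv, adLinear_apply] using Ad_mem_lieAlg_self g⁻¹ hY

theorem coe_adInvLie (g : G) (Y : lieAlg G) :
    (adInvLie g Y : Matrix (Fin n) (Fin n) ℂ) = Ad (g : GL (Fin n) ℂ)⁻¹ Y := rfl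

theorem continuous_adInvLie (g : G) : Continuous (adInvLie g) :=
  ((continuous_Ad _).comp continuous_subtype_val).subtype_mk _

end Adjoint

/-! ### Conjugates of Anosov representations -/

section Conjugation

variable {Γ : Type*} [Group Γ] {n : ℕ} {G : Subgroup (GL (Fin n) ℂ)}

theorem conjRep_apply (g : G) (ρ : Γ →* G) (γ : Γ) : conjRep g ρ γ = g * ρ γ * g⁻¹ := rfl

theorem conjRep_inv_conjRep (g : G) (ρ : Γ →* G) : conjRep g⁻¹ (conjRep g ρ) = ρ := by
  ext γ : 1
  simp [conjRep_apply, mul_assoc]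

theorem conjRep_apply_smul {X : Type*} [MulAction G X] (g : G) (ρ : Γ →* G) (γ : Γ) (x : X) :
    conjRep g ρ γ • g • x = g • ρ γ • x := by
  rw [conjRep_apply, smul_smul, inv_mul_cancel_right, mul_smul]

/-- The norms `N m ∘ Ad(g⁻¹)` on the tangent spaces at `g ξ(τ m)`. -/
theorem IsNormFamily.conj {S : Set Γ} {𝓕 : FlowSpace S} {ρ : Γ →* G} {P : Subgroup G}
    {ξ : Bdry S → G ⧸ P} {τ : 𝓕.carrier → Bdry S} {N : 𝓕.carrier → Seminorm ℝ (lieAlg G)}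
    (h : IsNormFamily 𝓕 ρ ξ τ N) (g : G) :
    IsNormFamily 𝓕 (conjRep g ρ) (fun z => g • ξ z) τ (fun m => (N m).comp (adInvLie g)) where
  norm_eq_zero_iff m Y := by
    rw [Seminorm.comp_apply, h.norm_eq_zero_iff, coe_adInvLie, Ad_inv_mem_stabAlg_iff]
  continuous :=
    h.continuous.comp (continuous_fst.prodMk ((continuous_adInvLie g).comp continuous_snd))
  equivariant γ m Y Y' hY := by
    refine h.equivariant γ m _ _ ?_
    simp only [coe_adInvLie, hY, conjRep_apply, Subgroup.coe_mul, Subgroup.coe_inv, ← Ad_mul]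
    congr 1
    group

theorem IsAnosovWith.conj {S : Set Γ} {P Q : Subgroup G} {ρ : Γ →* G} {ξp : Bdry S → G ⧸ P}
    {ξm : Bdry S → G ⧸ Q} (h : IsAnosovWith S ρ ξp ξm) (g : G) :
    IsAnosovWith S (conjRep g ρ) (fun z => g • ξp z) (fun z => g • ξm z) where
  continuous_plus := h.continuous_plus.const_smul g
  continuous_minus := h.continuous_minus.const_smul g
  equivariant_plus γ z := by rw [h.equivariant_plus, conjRep_apply_smul]
  equivariant_minus γ z := by rw [h.equivariant_minus, conjRep_apply_smul]
  transverse z w hzw := by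
    obtain ⟨k, hp, hm⟩ := h.transverse z w hzw
    exact ⟨g * k, by rw [hp]; rfl, by rw [hm]; rfl⟩
  contraction := by
    obtain ⟨𝓕, Np, Nm, hp, hm, A, a, hA, ha, hc⟩ := h.contraction
    exact ⟨𝓕, _, _, hp.conj g, hm.conj g, A, a, hA, ha, fun t ht m Y => hc t ht m (adInvLie g Y)⟩

theorem IsLimitMap.conj {S : Set Γ} {P : Subgroup G} {ρ : Γ →* G} {ξ : Bdry S → G ⧸ P}
    (h : IsLimitMap S P ρ ξ) (g : G) : IsLimitMap S P (conjRep g ρ) (fun z => g • ξ z) := by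
  obtain ⟨Q, ξm, hPQ, hA⟩ := h
  exact ⟨Q, _, hPQ, hA.conj g⟩

/-- The polynomial `u ↦ f (g u g⁻¹)` in the matrix entries of `u`. -/
def conjPoly (g : GL (Fin n) ℂ) (f : MvPolynomial (Fin n × Fin n) ℂ) :
    MvPolynomial (Fin n × Fin n) ℂ :=
  MvPolynomial.bind₁ (fun p => ∑ j, (∑ i, MvPolynomial.C ((g : Matrix (Fin n) (Fin n) ℂ) p.1 i) *
    MvPolynomial.X (i, j)) *
      MvPolynomial.C (((g⁻¹ : GL (Fin n) ℂ) : Matrix (Fin n) (Fin n) ℂ) j p.2)) f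

theorem eval_conjPoly (g u : GL (Fin n) ℂ) (f : MvPolynomial (Fin n × Fin n) ℂ) :
    MvPolynomial.eval (fun p => (u : Matrix (Fin n) (Fin n) ℂ) p.1 p.2) (conjPoly g f) =
      MvPolynomial.eval
        (fun p => ((g * u * g⁻¹ : GL (Fin n) ℂ) : Matrix (Fin n) (Fin n) ℂ) p.1 p.2) f := by
  unfold conjPoly
  rw [MvPolynomial.eval, MvPolynomial.eval₂Hom_bind₁]
  congr 2
  funext p
  simp [Units.val_mul, Matrix.mul_apply]

theorem IsZariskiDense.conj {ρ : Γ →* G} (h : IsZariskiDense ρ) (g : G) :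
    IsZariskiDense (conjRep g ρ) := by
  intro f hf k
  have hk := h (conjPoly g f) (fun γ => by rw [eval_conjPoly]; exact hf γ) (g⁻¹ * k * g)
  rw [eval_conjPoly] at hk
  simpa [mul_assoc] using hk

theorem conjRep_mem_homZD {S : Set Γ} {P : Subgroup G} {ρ : Γ →* G} (h : ρ ∈ homZD S P) (g : G) :
    conjRep g ρ ∈ homZD S P :=
  ⟨h.1.conj g, h.2.imp' _ fun _ hξ => hξ.conj g⟩

theorem pos_smul_smul {P H : Subgroup G} (g : G) (x : G ⧸ P) (y : G ⧸ H) :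
    pos (g • x) (g • y) = pos x y := by
  induction x using Quotient.inductionOn with | h a => ?_
  induction y using Quotient.inductionOn with | h b => ?_
  change DoubleCoset.mk P H ((g * a)⁻¹ * (g * b)) = DoubleCoset.mk P H (a⁻¹ * b)
  congr 1
  group

theorem smul_mem_domain_conjRep {S : Set Γ} {P H : Subgroup G} {I : Set (DCoset P H)}
    {ρ : Γ →* G} (g : G) {x : G ⧸ H} (hx : x ∈ domain S P H I ρ) :
    g • x ∈ domain S P H I (conjRep g ρ) := by
  intro ξ hξ z
  have h := hx _ (by simpa only [conjRep_inv_conjRep] using hξ.conj g⁻¹) z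
  rwa [← pos_smul_smul g, smul_inv_smul] at h

theorem domain_conjRep (S : Set Γ) (P H : Subgroup G) (I : Set (DCoset P H)) (ρ : Γ →* G)
    (g : G) : domain S P H I (conjRep g ρ) = g • domain S P H I ρ := by
  ext x
  rw [Set.mem_smul_set_iff_inv_smul_mem]
  constructor <;> intro h
  · simpa only [conjRep_inv_conjRep] using smul_mem_domain_conjRep g⁻¹ h
  · simpa only [smul_inv_smul] using smul_mem_domain_conjRep g h

end Conjugation

/-! ### Transport of complex structures along homeomorphisms -/

section Transport

variable {E M M' : Type*} [NormedAddCommGroup E] [NormedSpace ℂ E] [TopologicalSpace M]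
  [TopologicalSpace M'] [ChartedSpace E M]

/-- The charts of `M` pushed forward along a homeomorphism. `Homeomorph.chartedSpace` composes with
local inverses obtained by choice instead of `e.symm`, which would obscure the chart changes. -/
abbrev transportCharts (E : Type*) [TopologicalSpace E] [ChartedSpace E M] (e : M ≃ₜ M') :
    ChartedSpace E M' where
  atlas := (fun c => e.symm.transOpenPartialHomeomorph c) '' atlas E M
  chartAt m := e.symm.transOpenPartialHomeomorph (chartAt E (e.symm m))
  mem_chart_source m := mem_chart_source E (e.symm m)
  chart_mem_atlas m := Set.mem_image_of_mem _ (chart_mem_atlas E (e.symm m))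

theorem isManifold_transportCharts [IsManifold 𝓘(ℂ, E) ω M] (e : M ≃ₜ M') :
    letI := transportCharts E e
    IsManifold 𝓘(ℂ, E) ω M' := by
  let := transportCharts E e
  refine { compatible := ?_ }
  rintro _ _ ⟨c, hc, rfl⟩ ⟨c', hc', rfl⟩
  -- The two copies of `e` cancel, so the chart changes are those of `M`.
  have h : (e.symm.transOpenPartialHomeomorph c).symm.trans (e.symm.transOpenPartialHomeomorph c') =
      c.symm.trans c' := by
    ext x <;> simp
  rw [h]
  exact StructureGroupoid.compatible _ hc hc'

/-- In the charts at corresponding points, `e` and its inverse read as the identity of `M` does. -/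
theorem mdifferentiable_transportCharts (e : M ≃ₜ M') :
    letI := transportCharts E e
    MDifferentiable 𝓘(ℂ, E) 𝓘(ℂ, E) e ∧ MDifferentiable 𝓘(ℂ, E) 𝓘(ℂ, E) e.symm := by
  let := transportCharts E e
  have key : ∀ m : M, DifferentiableWithinAt ℂ (writtenInExtChartAt 𝓘(ℂ, E) 𝓘(ℂ, E) m (id : M → M))
      (Set.range 𝓘(ℂ, E)) (extChartAt 𝓘(ℂ, E) m m) := fun m =>
    (mdifferentiableAt_iff _ _).mp mdifferentiableAt_id |>.2
  have hchart : ∀ m : M',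
      chartAt E m = e.symm.transOpenPartialHomeomorph (chartAt E (e.symm m)) := fun _ => rfl
  constructor
  · intro m
    refine (mdifferentiableAt_iff _ _).mpr ⟨e.continuous.continuousAt, ?_⟩
    convert key m using 1
    funext x
    simp [writtenInExtChartAt, extChartAt, hchart]
  · intro m
    refine (mdifferentiableAt_iff _ _).mpr ⟨e.symm.continuous.continuousAt, ?_⟩
    convert key (e.symm m) using 1
    · funext x
      simp [writtenInExtChartAt, extChartAt, hchart]
    · simp [extChartAt, hchart]

end Transport

section Curves

variable {n : ℕ} {G : Subgroup (GL (Fin n) ℂ)} {H : Subgroup G} {Γ : Type*} [Group Γ]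

/-- The homeomorphism `m ↦ g m` between subsets of `G/H`. -/
def smulHomeomorph (g : G) {M M' : Set (G ⧸ H)} (hM : M' = g • M) : M ≃ₜ M' :=
  (Homeomorph.smul g).subtype fun x => by
    rw [hM]
    exact Set.smul_mem_smul_set_iff.symm

theorem coe_smulHomeomorph (g : G) {M M' : Set (G ⧸ H)} (hM : M' = g • M) (m : M) :
    (smulHomeomorph g hM m : G ⧸ H) = g • (m : G ⧸ H) := rfl

theorem coe_smulHomeomorph_symm (g : G) {M M' : Set (G ⧸ H)} (hM : M' = g • M) (m : M') :
    ((smulHomeomorph g hM).symm m : G ⧸ H) = g⁻¹ • (m : G ⧸ H) := rfl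

/-- The complex structure on `g M` for which `m ↦ g m` is biholomorphic. -/
def CurveStructure.transport {ρ : Γ →* G} {M M' : Set (G ⧸ H)} (C : CurveStructure ρ M) (g : G)
    (hM : M' = g • M) : CurveStructure (conjRep g ρ) M' where
  charted :=
    letI := C.charted
    transportCharts ℂ (smulHomeomorph g hM)
  isManifold :=
    letI := C.charted
    haveI := C.isManifold
    isManifold_transportCharts (smulHomeomorph g hM)
  holomorphic γ := by
    let := C.charted
    let := transportCharts ℂ (smulHomeomorph g hM)
    obtain ⟨f, hf, hd⟩ := C.holomorphic γ
    obtain ⟨h₁, h₂⟩ := mdifferentiable_transportCharts (E := ℂ) (smulHomeomorph g hM)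
    refine ⟨smulHomeomorph g hM ∘ f ∘ (smulHomeomorph g hM).symm, fun m => ?_,
      h₁.comp (hd.comp h₂)⟩
    simp only [Function.comp_apply, coe_smulHomeomorph, hf, coe_smulHomeomorph_symm, smul_smul,
      conjRep_apply, mul_assoc]

theorem CurveStructure.isBiholomorphic_transport {ρ : Γ →* G} {M M' : Set (G ⧸ H)}
    (C : CurveStructure ρ M) (g : G) (hM : M' = g • M) :
    C.IsBiholomorphic (C.transport g hM) (smulHomeomorph g hM).toEquiv :=
  letI := C.charted
  mdifferentiable_transportCharts (E := ℂ) (smulHomeomorph g hM)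

/-! ### The pullback bundles and their free group -/

theorem CurveStructure.smul_mem {ρ : Γ →* G} {M : Set (G ⧸ H)} (C : CurveStructure ρ M) {h : G}
    (hh : h ∈ ρ.range) {m : G ⧸ H} (hm : m ∈ M) : h • m ∈ M := by
  obtain ⟨γ, rfl⟩ := hh
  obtain ⟨f, hf, -⟩ := C.holomorphic γ
  exact hf ⟨m, hm⟩ ▸ (f ⟨m, hm⟩).2

/-- `𝓔^h = 𝓔^{h'}` only if `h` and `h'` agree on `M`: the fibre of `𝓔^h` over `m` contains the zero
vector of `T^{1,0}M` at `h m`, which recovers `h m`. -/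
theorem CurveStructure.pullbackBundle_eq_iff {ρ : Γ →* G} {M : Set (G ⧸ H)}
    (C : CurveStructure ρ M) {h h' : G} (hh : h ∈ ρ.range) :
    C.pullbackBundle h = C.pullbackBundle h' ↔ ∀ m ∈ M, h • m = h' • m := by
  let := C.charted
  constructor
  · intro heq m hm
    let x : C.TotalT10 := ⟨⟨h • m, C.smul_mem hh hm⟩, 0⟩
    have hx : ((⟨m, hm⟩, x) : M × C.TotalT10) ∈ C.pullbackBundle h := rfl
    rw [heq] at hx
    exact hx
  · intro hag
    ext ⟨m, x⟩
    change (x.1 : G ⧸ H) = h • (m : G ⧸ H) ↔ (x.1 : G ⧸ H) = h' • (m : G ⧸ H)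
    rw [hag m m.2]

theorem conj_mem_range_conjRep {ρ : Γ →* G} (g : G) {h : G} (hh : h ∈ ρ.range) :
    g * h * g⁻¹ ∈ (conjRep g ρ).range := by
  obtain ⟨γ, rfl⟩ := hh
  exact ⟨γ, rfl⟩

theorem CurveStructure.pullbackBundle_conj_eq_iff {ρ : Γ →* G} {M M' : Set (G ⧸ H)}
    (C : CurveStructure ρ M) (g : G) (C' : CurveStructure (conjRep g ρ) M') (hM : M' = g • M)
    {h h' : G} (hh : h ∈ ρ.range) :
    C'.pullbackBundle (g * h * g⁻¹) = C'.pullbackBundle (g * h' * g⁻¹) ↔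
      C.pullbackBundle h = C.pullbackBundle h' := by
  rw [C'.pullbackBundle_eq_iff (conj_mem_range_conjRep g hh), C.pullbackBundle_eq_iff hh, hM]
  change (∀ x ∈ (g • ·) '' M, _) ↔ _
  rw [Set.forall_mem_image]
  simp only [smul_smul, inv_mul_cancel_right]
  simp only [mul_smul, smul_left_cancel_iff]

theorem CurveStructure.exists_lineBundles_equiv {ρ : Γ →* G} {M M' : Set (G ⧸ H)}
    (C : CurveStructure ρ M) (g : G) (C' : CurveStructure (conjRep g ρ) M') (hM : M' = g • M) :
    ∃ φ : C.lineBundles ≃ C'.lineBundles, ∀ h ∈ ρ.range, ∀ E : C.lineBundles,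
      E.1 = C.pullbackBundle h → (φ E).1 = C'.pullbackBundle (g * h * g⁻¹) := by
  have hne : M'.Nonempty ↔ M.Nonempty := by rw [hM, Set.smul_set_nonempty]
  choose k hk hEk using fun E : C.lineBundles => E.2.2
  let φ : C.lineBundles → C'.lineBundles := fun E =>
    ⟨C'.pullbackBundle (g * k E * g⁻¹), hne.mpr E.2.1, _, conj_mem_range_conjRep g (hk E), rfl⟩
  have hφ : ∀ h ∈ ρ.range, ∀ E : C.lineBundles, E.1 = C.pullbackBundle h →
      (φ E).1 = C'.pullbackBundle (g * h * g⁻¹) := fun h _ E hE =>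
    (C.pullbackBundle_conj_eq_iff g C' hM (hk E)).mpr ((hEk E).symm.trans hE)
  refine ⟨Equiv.ofBijective φ ⟨fun E E' hEE' => ?_, ?_⟩, hφ⟩
  · refine Subtype.ext ?_
    rw [hEk E, hEk E']
    exact (C.pullbackBundle_conj_eq_iff g C' hM (hk E)).mp (congrArg Subtype.val hEE')
  · rintro ⟨E', hM', h', ⟨γ, rfl⟩, rfl⟩
    exact ⟨⟨C.pullbackBundle (ρ γ), hne.mp hM', ρ γ, ⟨γ, rfl⟩, rfl⟩,
      Subtype.ext (hφ (ρ γ) ⟨γ, rfl⟩ _ rfl)⟩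

theorem CurveStructure.exists_freeGroup_mulEquiv {ρ : Γ →* G} {M M' : Set (G ⧸ H)}
    (C : CurveStructure ρ M) (g : G) (C' : CurveStructure (conjRep g ρ) M') (hM : M' = g • M) :
    ∃ ψ : C.freeGroup ≃* C'.freeGroup,
      ∀ h ∈ ρ.range, ∀ (E : C.lineBundles) (E' : C'.lineBundles),
        E.1 = C.pullbackBundle h → E'.1 = C'.pullbackBundle (g * h * g⁻¹) →
        ψ (FreeGroup.of E) = FreeGroup.of E' := by
  obtain ⟨φ, hφ⟩ := C.exists_lineBundles_equiv g C' hM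
  refine ⟨FreeGroup.freeGroupCongr φ, fun h hh E E' hE hE' => ?_⟩
  have h : φ E = E' := Subtype.ext ((hφ h hh E hE).trans hE'.symm)
  simp [h]

end Curves

/-! ### Descent to the character variety -/

section Descent

variable {Γ : Type*} [Group Γ] {n : ℕ} {G : Subgroup (GL (Fin n) ℂ)}

theorem exists_group_on_characterVariety (S : Set Γ) (P H : Subgroup G) (I : Set (DCoset P H)) :
    ∃ Φ : CharacterVariety S P → GrpCat.{0},
      ∀ (ρ : homZD S P) (C : CurveStructure ρ.1 (domain S P H I ρ.1)),
        Nonempty (C.freeGroup ≃* Φ (CharacterVariety.mk ρ)) := by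
  suffices h : ∀ c : CharacterVariety S P, ∃ A : GrpCat.{0}, ∀ ρ : homZD S P,
      CharacterVariety.mk ρ = c → ∀ C : CurveStructure ρ.1 (domain S P H I ρ.1),
        Nonempty (C.freeGroup ≃* A) by
    choose Φ hΦ using h
    exact ⟨Φ, fun ρ C => hΦ _ ρ rfl C⟩
  intro c
  by_cases hc : ∃ ρ₀ : homZD S P, CharacterVariety.mk ρ₀ = c ∧
      Nonempty (CurveStructure ρ₀.1 (domain S P H I ρ₀.1))
  · obtain ⟨ρ₀, rfl, ⟨C₀⟩⟩ := hc
    refine ⟨GrpCat.of C₀.freeGroup, ?_⟩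
    rintro ⟨ρ, hρ⟩ hρ₀ C
    obtain ⟨g, hg⟩ : ∃ g : G, ρ = conjRep g ρ₀.1 := Quotient.exact hρ₀.symm
    subst hg
    obtain ⟨ψ, -⟩ := C₀.exists_freeGroup_mulEquiv g C (domain_conjRep S P H I ρ₀.1 g)
    exact ⟨ψ.symm⟩
  · exact ⟨GrpCat.of PUnit, fun ρ hρ C => absurd ⟨ρ, hρ, ⟨C⟩⟩ hc⟩

end Descent

end AnosovFree

end

open AnosovFree in
theorem mainTheorem6
    {Γ : Type*} [Group Γ] (S : Set Γ) (hS : IsWordHyperbolic S)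
    {n : ℕ} (G : Subgroup (GL (Fin n) ℂ)) (hG : IsSemisimpleAlgebraic G)
    (P : Subgroup G) (hP : IsSelfOppositeParabolic G P)
    (H : Subgroup G) (hH : IsClosed (H : Set G)) (hfin : Finite (DCoset P H))
    (I : Set (DCoset P H)) (hI : IsPosIdeal I) :
    (∀ ρ ∈ homZD S P, ∀ g : G,
      conjRep g ρ ∈ homZD S P ∧
      (∀ ξ : Bdry S → G ⧸ P, IsLimitMap S P ρ ξ →
        IsLimitMap S P (conjRep g ρ) (fun z => g • ξ z)) ∧
      domain S P H I (conjRep g ρ) = g • domain S P H I ρ ∧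
      (∀ C : CurveStructure ρ (domain S P H I ρ),
        ∃ (C' : CurveStructure (conjRep g ρ) (domain S P H I (conjRep g ρ)))
          (f : domain S P H I ρ ≃ domain S P H I (conjRep g ρ)),
          (∀ m, (f m : G ⧸ H) = g • (m : G ⧸ H)) ∧ C.IsBiholomorphic C' f) ∧
      (∀ (C : CurveStructure ρ (domain S P H I ρ))
        (C' : CurveStructure (conjRep g ρ) (domain S P H I (conjRep g ρ))),
        ∃ ψ : C.freeGroup ≃* C'.freeGroup,
          ∀ h ∈ ρ.range, ∀ (E : C.lineBundles) (E' : C'.lineBundles),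
            E.1 = C.pullbackBundle h → E'.1 = C'.pullbackBundle (g * h * g⁻¹) →
            ψ (FreeGroup.of E) = FreeGroup.of E')) ∧
    (∃ Φ : CharacterVariety S P → GrpCat.{0},
      ∀ (ρ : homZD S P) (C : CurveStructure ρ.1 (domain S P H I ρ.1)),
        Nonempty (C.freeGroup ≃* Φ (CharacterVariety.mk ρ))) := by
  refine ⟨fun ρ hρ g => ?_, exists_group_on_characterVariety S P H I⟩
  have hM := domain_conjRep S P H I ρ g
  exact ⟨conjRep_mem_homZD hρ g, fun ξ hξ => hξ.conj g, hM,
    fun C => ⟨C.transport g hM, (smulHomeomorph g hM).toEquiv, coe_smulHomeomorph g hM,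
      C.isBiholomorphic_transport g hM⟩,
    fun C C' => C.exists_freeGroup_mulEquiv g C' hM⟩
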